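/- Let $m,n_0\ge 1$ be integers. For $i=1,\dots,m$ let $\mu_i$ be a probability distribution of labelled data $(\mathbf{x},y)$, and let the training data $(\mathbf{x}^i_j,y^i_j)$, $1\le i\le m$, $1\le j\le n_0$, be independent with $(\mathbf{x}^i_j,y^i_j)\sim\mu_i$. Let $f_i(\mathbf{x};\Theta)\in\mathbb{R}$ be the learning function of task $i$ with parameter $\Theta$ (measurable in $\mathbf{x}$), let $l(\cdot,\cdot)$ be a measurable loss function with values in $[0,1]$ which is Lipschitz in its first argument with constant $\rho\ge 0$, and let $\mathcal{C}=\{\Theta : r(\Theta)\le\beta\}$ for a real-valued function $r$ and $\beta\in\mathbb{R}$. Assume the usual measurability condition that $\mathcal{C}$ has a countable subset $\mathcal{C}_0$ such that for every $\Theta\in\mathcal{C}$ there are $\Theta_k\in\mathcal{C}_0$ with $f_i(\mathbf{x};\Theta_k)\to f_i(\mathbf{x};\Theta)$ for all $i$ and $\mathbf{x}$ (for example, $\mathcal{C}\subseteq\mathbb{R}^d$ and each $f_i(\mathbf{x};\cdot)$ continuous). Put $$R_i(\Theta)=\mathbb{E}_{(\mathbf{x},y)\sim\mu_i}[l(f_i(\mathbf{x};\Theta),y)],\quad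 R_I(\Theta)=\frac1m\sum_{i=1}^m R_i(\Theta),\quad \hat R_i(\Theta)=\frac1{n_0}\sum_{j=1}^{n_0} l(f_i(\mathbf{x}^i_j;\Theta),y^i_j).$$ Let $T>0$, $h(x)=\exp\{x/T\}$, $\hat R_h(\Theta)=\frac1m\sum_{i=1}^m h(\hat R_i(\Theta))$, $\nu=\frac1T\exp\{\frac1T\}$ and $\eta=\frac2m\exp\{\frac1T\}\left(\exp\{\frac1{n_0T}\}-1\right)$. Let $$\mathfrak{R}=\mathbb{E}\left[\sup_{\Theta\in\mathcal{C}}\left\{\sum_{i=1}^m\frac{\sigma_i}{n_0m}\sum_{j=1}^{n_0}f_i(\mathbf{x}^i_j;\Theta)\right\}\right],$$ where $\sigma_1,\dots,\sigma_m$ are independent uniform $\{\pm1\}$-valued random variables, independent of the training data, and the expectation is over both the training data and the $\sigma_i$; assume that this supremum is almost surely finite and integrable. Then for every $\delta>0$, with probability at least $1-\delta$ over the training data, the following inequality holds simultaneously for all $\Theta\in\mathcal{C}$: $$R_I(\Theta)\le T\ln\left(8\rho\nu\,\mathfrak{R}+\hat R_h(\Theta)+\sqrt{\frac{\eta^2mn_0}{2}\ln\frac1\delta}\right)$$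 (for $\delta\ge1$ the claim is void). -/

import Mathlib

open MeasureTheory ProbabilityTheory Filter Topology
open scoped NNReal

noncomputable section

namespace BMTL

variable {X Y Ω Param : Type*} {m n : ℕ}

/-- The constraint set `{Θ | r Θ ≤ β}`. -/
def constraintSet (r : Param → ℝ) (β : ℝ) : Set Param := {Θ | r Θ ≤ β}

/-- The transformation `h(z) = exp(z / T)`. -/
def expTransform (T z : ℝ) : ℝ := Real.exp (z / T)

/-- The expected loss `R_i(Θ)` of task `i`, with data distribution `μ i`. -/
def taskRisk [MeasurableSpace X] [MeasurableSpace Y] (l : ℝ → Y → ℝ)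
    (f : Fin m → X → Param → ℝ) (μ : Fin m → Measure (X × Y)) (i : Fin m) (Θ : Param) : ℝ :=
  ∫ z, l (f i z.1 Θ) z.2 ∂(μ i)

/-- The average expected loss `R_I(Θ)` of the direct sum approach. -/
def averageRisk [MeasurableSpace X] [MeasurableSpace Y] (l : ℝ → Y → ℝ)
    (f : Fin m → X → Param → ℝ) (μ : Fin m → Measure (X × Y)) (Θ : Param) : ℝ :=
  (1 / (m : ℝ)) * ∑ i, taskRisk l f μ i Θ

/-- The empirical loss of task `i` on the training data `D`, where `D i j` is the `j`-th labelled
data point of task `i`. -/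
def empiricalTaskRisk (l : ℝ → Y → ℝ) (f : Fin m → X → Param → ℝ)
    (D : Fin m → Fin n → X × Y) (i : Fin m) (Θ : Param) : ℝ :=
  (1 / (n : ℝ)) * ∑ j, l (f i (D i j).1 Θ) (D i j).2

/-- The empirical loss over all tasks, with the transformation `h` applied to each task. -/
def empiricalRisk (h : ℝ → ℝ) (l : ℝ → Y → ℝ) (f : Fin m → X → Param → ℝ)
    (D : Fin m → Fin n → X × Y) (Θ : Param) : ℝ :=
  (1 / (m : ℝ)) * ∑ i, h (empiricalTaskRisk l f D i Θ)

/-- `∑ i, σ_i / (n m) * ∑ j, f_i(x_{ij}; Θ)`, for one sign `σ_i ∈ {1, -1}` per task. -/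
def signedSum (f : Fin m → X → Param → ℝ) (D : Fin m → Fin n → X × Y) (σ : Fin m → ℤˣ)
    (Θ : Param) : ℝ :=
  ∑ i, (((σ i : ℤ) : ℝ) / ((n : ℝ) * (m : ℝ))) * ∑ j, f i (D i j).1 Θ

/-- The supremum of `signedSum` over the constraint set. -/
def signedSup (f : Fin m → X → Param → ℝ) (C : Set Param) (D : Fin m → Fin n → X × Y)
    (σ : Fin m → ℤˣ) : ℝ :=
  sSup (signedSum f D σ '' C)

/-- The expectation of `signedSup` over the random training data and over independent
Rademacher signs, i.e. `σ` uniform on `{1, -1}^m` and independent of the data. -/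
def rademacherComplexity [MeasurableSpace Ω] (P : Measure Ω) (f : Fin m → X → Param → ℝ)
    (C : Set Param) (S : Fin m → Fin n → Ω → X × Y) : ℝ :=
  ∫ ω, (1 / (2 : ℝ) ^ m) * ∑ σ : Fin m → ℤˣ, signedSup f C (fun i j => S i j ω) σ ∂P

/-- The supremum in `rademacherComplexity` is almost surely finite and has finite expectation. -/
def HasRademacherComplexity [MeasurableSpace Ω] (P : Measure Ω) (f : Fin m → X → Param → ℝ)
    (C : Set Param) (S : Fin m → Fin n → Ω → X × Y) : Prop :=
  ∀ σ : Fin m → ℤˣ,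
    (∀ᵐ ω ∂P, BddAbove (signedSum f (fun i j => S i j ω) σ '' C)) ∧
    Integrable (fun ω => signedSup f C (fun i j => S i j ω) σ) P

/-- Pointwise measurability of the class `{f(·; Θ) | Θ ∈ C}`: every member is the pointwise limit
of a sequence from a fixed countable part of the class. It holds for instance when `C` is a subset
of a Euclidean space and each `f_i(x; ·)` is continuous, and it is what makes suprema over `C`
measurable. -/
def PointwiseSeparable (f : Fin m → X → Param → ℝ) (C : Set Param) : Prop :=
  ∃ C₀ ⊆ C, C₀.Countable ∧ ∀ Θ ∈ C, ∃ u : ℕ → Param, (∀ k, u k ∈ C₀) ∧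
    ∀ i x, Tendsto (fun k => f i x (u k)) atTop (𝓝 (f i x Θ))

/-- `ν = (1 / T) exp(1 / T)`. -/
def nu (T : ℝ) : ℝ := (1 / T) * Real.exp (1 / T)

/-- `η = (2 / m) exp(1 / T) (exp(1 / (n T)) - 1)`. -/
def eta (m n : ℕ) (T : ℝ) : ℝ :=
  (2 / (m : ℝ)) * Real.exp (1 / T) * (Real.exp (1 / ((n : ℝ) * T)) - 1)

end BMTL

end

/-! Call the gap of Θ the average risk minus the plain mean of the empirical task risks. If the gap
is at most `B ≥ 0`, then, since risks are at most 1, exp(R_I/T) exceeds the exponential of that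
empirical mean over T by at most νB, and Jensen bounds the latter exponential by R̂_h
(`averageRisk_le_of_riskGap_le`). So it suffices that with probability at least 1 - δ the gap is
uniformly at most 8ρ𝔑 + ε, where 𝔑 is the Rademacher complexity and ε = √(2 ln(1/δ)/(mn));
`nu_mul_sqrt_le` puts νε below the stated root.

Over finitely many parameters, mn times the largest gap is the largest coordinate of a sum of mn
independent vectors of sup norm at most 1. It concentrates by bounded differences
(`hasSubgaussianMGF_lipschitz_sum`), and its mean is bounded in `integral_coordMax_deviation_le`.

The difficulty in the mean is that 𝔑 carries one sign per task, not one per observation. Within a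
task, convexity, Jensen and contraction replace centred losses by individually signed outputs, at
the cost of a factor 2. The signs then split the observations into two blocks. Each block is
dominated by the full sum, because the missing block may be replaced by its mean, and all
observations of a task have the same mean; the cost is a factor 4. Signs are inserted once more, now
across tasks (`integral_coordMax_sum_le`), which gives 8ρ𝔑.

A monotone limit passes to countable classes, and pointwise separability to the whole constraint
set. -/

namespace BMTL

/-! ### Convexity and contraction for the maximum of finitely many coordinates -/

section CoordMax

variable {K : Type*} [Fintype K] [Nonempty K]

/-- The largest coordinate of a vector. -/
noncomputable def coordMax (x : K → ℝ) : ℝ := Finset.univ.sup' Finset.univ_nonempty x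

/-- The average of the largest coordinate of `a + x` and that of `a - x`. -/
noncomputable def symMax (a x : K → ℝ) : ℝ := (coordMax (a + x) + coordMax (a - x)) / 2

lemma le_coordMax (x : K → ℝ) (k : K) : x k ≤ coordMax x :=
  Finset.le_sup' x (Finset.mem_univ k)

lemma coordMax_le {x : K → ℝ} {c : ℝ} (h : ∀ k, x k ≤ c) : coordMax x ≤ c :=
  Finset.sup'_le _ _ fun k _ => h k

lemma exists_coordMax_eq (x : K → ℝ) : ∃ k, coordMax x = x k := by
  obtain ⟨k, -, hk⟩ := Finset.exists_mem_eq_sup' Finset.univ_nonempty x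
  exact ⟨k, hk⟩

lemma lipschitzWith_coordMax : LipschitzWith 1 (coordMax : (K → ℝ) → ℝ) := by
  refine LipschitzWith.of_le_add fun x y => coordMax_le fun k => ?_
  have h1 := le_coordMax y k
  have h2 : dist (x k) (y k) ≤ dist x y := dist_le_pi_dist x y k
  rw [Real.dist_eq] at h2
  linarith [le_abs_self (x k - y k)]

lemma continuous_coordMax : Continuous (coordMax : (K → ℝ) → ℝ) :=
  lipschitzWith_coordMax.continuous

lemma abs_coordMax_le (x : K → ℝ) : |coordMax x| ≤ ‖x‖ := by
  obtain ⟨k, hk⟩ := exists_coordMax_eq x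
  rw [hk]
  exact norm_le_pi_norm x k

/-- Midpoint convexity. The doubling of `x` and `y` is the source of every factor 2 in the constant
8. -/
lemma coordMax_add_add_le (a x y : K → ℝ) :
    coordMax (a + (x + y)) ≤
      (coordMax (a + (2 : ℝ) • x) + coordMax (a + (2 : ℝ) • y)) / 2 := by
  refine coordMax_le fun k => ?_
  have h1 := le_coordMax (a + (2 : ℝ) • x) k
  have h2 := le_coordMax (a + (2 : ℝ) • y) k
  simp only [Pi.add_apply, Pi.smul_apply, smul_eq_mul] at h1 h2 ⊢
  linarith

lemma symMax_neg (a x : K → ℝ) : symMax a (-x) = symMax a x := by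
  simp only [symMax, sub_neg_eq_add, ← sub_eq_add_neg]
  ring

lemma symMax_add_le (a x y : K → ℝ) :
    symMax a (x + y) ≤ (symMax a ((2 : ℝ) • x) + symMax a ((2 : ℝ) • y)) / 2 := by
  have h1 := coordMax_add_add_le a x y
  have h2 := coordMax_add_add_le a (-x) (-y)
  simp only [smul_neg, ← sub_eq_add_neg] at h2
  have h3 : a + (-x - y) = a - (x + y) := by abel
  rw [h3] at h2
  simp only [symMax]
  linarith

/-- The one-sign contraction principle. -/
lemma symMax_le_of_abs_sub_le (a : K → ℝ) {x y : K → ℝ}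
    (h : ∀ k k', |x k - x k'| ≤ |y k - y k'|) : symMax a x ≤ symMax a y := by
  obtain ⟨k, hk⟩ := exists_coordMax_eq (a + x)
  obtain ⟨k', hk'⟩ := exists_coordMax_eq (a - x)
  simp only [symMax]
  rw [hk, hk']
  have h1 := le_coordMax (a + y) k
  have h2 := le_coordMax (a - y) k'
  have h3 := le_coordMax (a + y) k'
  have h4 := le_coordMax (a - y) k
  have h5 := (le_abs_self _).trans (h k k')
  simp only [Pi.add_apply, Pi.sub_apply] at *
  -- Depending on the sign of `y k - y k'`, the maximisers keep their roles on the right (`h1`,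
  -- `h2`) or exchange them (`h3`, `h4`).
  rcases abs_cases (y k - y k') with ⟨h6, _⟩ | ⟨h6, _⟩ <;> rw [h6] at h5 <;> linarith

lemma continuous_symMax (a : K → ℝ) : Continuous (symMax a) := by
  unfold symMax
  have := continuous_coordMax (K := K)
  fun_prop

end CoordMax

/-! ### Independent pairs and Fubini -/

section Independence

variable {Ω α β : Type*} [MeasurableSpace Ω] [MeasurableSpace α] [MeasurableSpace β]
  {P : Measure Ω}

/-- Subfamilies of an independent family along index maps with disjoint ranges are independent. -/
lemma indepFun_of_disjoint_range {ι κ κ' : Type*} [Finite κ] [Finite κ'] {W : ι → Ω → α}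
    (h : iIndepFun W P) (hW : ∀ i, AEMeasurable (W i) P) (e : κ → ι) (e' : κ' → ι)
    (hd : ∀ k k', e k ≠ e' k') :
    IndepFun (fun ω k => W (e k) ω) (fun ω k' => W (e' k') ω) P := by
  classical
  have := Fintype.ofFinite κ
  have := Fintype.ofFinite κ'
  have hdis : Disjoint (Finset.univ.image e) (Finset.univ.image e') := by
    simp only [Finset.disjoint_left, Finset.mem_image, Finset.mem_univ, true_and]
    rintro _ ⟨k, rfl⟩ ⟨k', hk'⟩
    exact hd k k' hk'.symm
  exact (h.indepFun_finset₀ _ _ hdis hW).comp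
    (φ := fun t k => t ⟨e k, Finset.mem_image_of_mem e (Finset.mem_univ k)⟩)
    (ψ := fun t k' => t ⟨e' k', Finset.mem_image_of_mem e' (Finset.mem_univ k')⟩)
    (by fun_prop) (by fun_prop)

variable [IsProbabilityMeasure P]

/-- Independence realises the joint law on `Ω × Ω` with one variable on each factor, so that
conditioning on one of them becomes an iterated integral. -/
lemma map_prodMk_comp_eq_map {A : Ω → α} {B : Ω → β} (hA : AEMeasurable A P)
    (hB : AEMeasurable B P) (h : IndepFun A B P) :
    (P.prod P).map (fun q : Ω × Ω => (A q.1, B q.2)) = P.map (fun ω => (A ω, B ω)) := by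
  have h1 := AEMeasurable.map_map_of_aemeasurable (μ := P.prod P) (f := Prod.fst) (g := A)
    (by rwa [measurePreserving_fst.map_eq]) measurable_fst.aemeasurable
  have h2 := AEMeasurable.map_map_of_aemeasurable (μ := P.prod P) (f := Prod.snd) (g := B)
    (by rwa [measurePreserving_snd.map_eq]) measurable_snd.aemeasurable
  rw [measurePreserving_fst.map_eq] at h1
  rw [measurePreserving_snd.map_eq] at h2
  rw [h.map_prod_eq_prod_map_map hA hB,
    (indepFun_prod₀ hA hB).map_prod_eq_prod_map_map hA.comp_fst hB.comp_snd, h1, h2]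
  rfl

lemma integrable_prod_of_indepFun {A : Ω → α} {B : Ω → β} (hA : AEMeasurable A P)
    (hB : AEMeasurable B P) (h : IndepFun A B P) {φ : α × β → ℝ} (hφ : Measurable φ)
    (hi : Integrable (fun ω => φ (A ω, B ω)) P) :
    Integrable (fun q : Ω × Ω => φ (A q.1, B q.2)) (P.prod P) := by
  have h1 : Integrable φ (P.map (fun ω => (A ω, B ω))) :=
    (integrable_map_measure hφ.aestronglyMeasurable (hA.prodMk hB)).2 hi
  rw [← map_prodMk_comp_eq_map hA hB h] at h1
  exact h1.comp_aemeasurable (hA.comp_fst.prodMk hB.comp_snd)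

lemma integral_eq_integral_integral_of_indepFun {A : Ω → α} {B : Ω → β} (hA : AEMeasurable A P)
    (hB : AEMeasurable B P) (h : IndepFun A B P) {φ : α × β → ℝ} (hφ : Measurable φ)
    (hi : Integrable (fun ω => φ (A ω, B ω)) P) :
    ∫ ω, φ (A ω, B ω) ∂P = ∫ ω, ∫ ω', φ (A ω, B ω') ∂P ∂P := by
  rw [← integral_prod _ (integrable_prod_of_indepFun hA hB h hφ hi),
    ← integral_map (hA.prodMk hB) hφ.aestronglyMeasurable, ← map_prodMk_comp_eq_map hA hB h,
    integral_map (hA.comp_fst.prodMk hB.comp_snd) hφ.aestronglyMeasurable]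

end Independence

/-! ### Jensen inequalities and insertion of random signs -/

section Symmetrization

variable {K : Type*} [Fintype K] [Nonempty K] {Ω : Type*} [MeasurableSpace Ω] {P : Measure Ω}

lemma integrable_coordMax {W : Ω → K → ℝ} (hW : Integrable W P) :
    Integrable (fun ω => coordMax (W ω)) P :=
  hW.norm.mono' (continuous_coordMax.comp_aestronglyMeasurable hW.1)
    (ae_of_all _ fun ω => abs_coordMax_le (W ω))

lemma coordMax_integral_le [IsProbabilityMeasure P] {W : Ω → K → ℝ} (hW : Integrable W P) :
    coordMax (∫ ω, W ω ∂P) ≤ ∫ ω, coordMax (W ω) ∂P := by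
  refine coordMax_le fun k => ?_
  rw [eval_integral fun k => hW.eval k]
  exact integral_mono (hW.eval k) (integrable_coordMax hW) fun ω => le_coordMax (W ω) k

variable [IsProbabilityMeasure P]

lemma integrable_symMax (a : K → ℝ) {W : Ω → K → ℝ} (hW : Integrable W P) :
    Integrable (fun ω => symMax a (W ω)) P :=
  ((integrable_coordMax ((integrable_const a).add hW)).add
    (integrable_coordMax ((integrable_const a).sub hW))).div_const 2

lemma integral_symMax (a : K → ℝ) {W : Ω → K → ℝ} (hW : Integrable W P) :
    ∫ ω, symMax a (W ω) ∂P =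
      (∫ ω, coordMax (a + W ω) ∂P + ∫ ω, coordMax (a - W ω) ∂P) / 2 := by
  simp only [symMax]
  have h1 : Integrable (fun ω => a + W ω) P := (integrable_const a).add hW
  have h2 : Integrable (fun ω => a - W ω) P := (integrable_const a).sub hW
  rw [integral_div, integral_add (integrable_coordMax h1) (integrable_coordMax h2)]

lemma symMax_integral_le (a : K → ℝ) {W : Ω → K → ℝ} (hW : Integrable W P) :
    symMax a (∫ ω, W ω ∂P) ≤ ∫ ω, symMax a (W ω) ∂P := by
  rw [integral_symMax a hW, symMax]
  have hp : Integrable (fun ω => a + W ω) P := (integrable_const a).add hW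
  have hm : Integrable (fun ω => a - W ω) P := (integrable_const a).sub hW
  have h1 := coordMax_integral_le hp
  have h2 := coordMax_integral_le hm
  rw [integral_add (integrable_const a) hW] at h1
  rw [integral_sub (integrable_const a) hW] at h2
  simp only [integral_const, probReal_univ, one_smul] at h1 h2
  linarith

/-- Conditional Jensen inequality: replacing an independent summand by its mean. -/
lemma integral_symMax_add_integral_le (a : K → ℝ) {A B : Ω → K → ℝ} (hA : Integrable A P)
    (hB : Integrable B P) (h : IndepFun A B P) :
    ∫ ω, symMax a (A ω + ∫ ω', B ω' ∂P) ∂P ≤ ∫ ω, symMax a (A ω + B ω) ∂P := by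
  have hφ : Measurable fun p : (K → ℝ) × (K → ℝ) => symMax a (p.1 + p.2) :=
    ((continuous_symMax a).comp (by fun_prop)).measurable
  have hi : Integrable (fun ω => symMax a (A ω + B ω)) P := integrable_symMax a (hA.add hB)
  rw [integral_eq_integral_integral_of_indepFun hA.1.aemeasurable hB.1.aemeasurable h hφ hi]
  refine integral_mono (integrable_symMax a (hA.add (integrable_const _)))
    (integrable_prod_of_indepFun hA.1.aemeasurable hB.1.aemeasurable h hφ hi).integral_prod_left
    fun ω => ?_
  have hAB : Integrable (fun ω' => A ω + B ω') P := (integrable_const (A ω)).add hB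
  have := symMax_integral_le a hAB
  rw [integral_add (integrable_const _) hB] at this
  simpa using this

/-- If `U` is dominated by the randomly signed `V` for every constant shift, it is so for every
independent random shift. -/
lemma integral_coordMax_add_le {R U V : Ω → K → ℝ} (hR : Integrable R P) (hU : Integrable U P)
    (hV : Integrable V P) (h : IndepFun R (fun ω => (U ω, V ω)) P)
    (hle : ∀ a, ∫ ω, coordMax (a + U ω) ∂P ≤ ∫ ω, symMax a (V ω) ∂P) :
    ∫ ω, coordMax (R ω + U ω) ∂P ≤
      (∫ ω, coordMax (R ω + V ω) ∂P + ∫ ω, coordMax (R ω - V ω) ∂P) / 2 := by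
  have hD : AEMeasurable (fun ω => (U ω, V ω)) P := hU.1.aemeasurable.prodMk hV.1.aemeasurable
  have h1 : Measurable fun p : (K → ℝ) × (K → ℝ) × (K → ℝ) => coordMax (p.1 + p.2.1) :=
    (continuous_coordMax.comp (by fun_prop)).measurable
  have h2 : Measurable fun p : (K → ℝ) × (K → ℝ) × (K → ℝ) => symMax p.1 p.2.2 := by
    have := continuous_coordMax (K := K)
    have h3 : Continuous fun p : (K → ℝ) × (K → ℝ) × (K → ℝ) => symMax p.1 p.2.2 := by
      unfold symMax; fun_prop
    exact h3.measurable
  have hi1 : Integrable (fun ω => coordMax (R ω + U ω)) P := integrable_coordMax (hR.add hU)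
  have hp : Integrable (fun ω => coordMax (R ω + V ω)) P := integrable_coordMax (hR.add hV)
  have hm : Integrable (fun ω => coordMax (R ω - V ω)) P := integrable_coordMax (hR.sub hV)
  have hi2 : Integrable (fun ω => symMax (R ω) (V ω)) P := (hp.add hm).div_const 2
  calc ∫ ω, coordMax (R ω + U ω) ∂P ≤ ∫ ω, symMax (R ω) (V ω) ∂P := by
        rw [integral_eq_integral_integral_of_indepFun hR.1.aemeasurable hD h h1 hi1,
          integral_eq_integral_integral_of_indepFun hR.1.aemeasurable hD h h2 hi2]
        exact integral_mono
          (integrable_prod_of_indepFun hR.1.aemeasurable hD h h1 hi1).integral_prod_left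
          (integrable_prod_of_indepFun hR.1.aemeasurable hD h h2 hi2).integral_prod_left
          fun ω => hle (R ω)
    _ = _ := by
        simp only [symMax]
        rw [integral_div, integral_add hp hm]

/-- Replacing independent summands `U i`, one at a time, by randomly signed summands `V i`. -/
theorem integral_coordMax_sum_le {ι : Type*} [Fintype ι] [DecidableEq ι] {U V : ι → Ω → K → ℝ}
    (hU : ∀ i, Integrable (U i) P) (hV : ∀ i, Integrable (V i) P)
    (h : ∀ i, IndepFun (fun ω (i' : {i' // i' ≠ i}) => (U i' ω, V i' ω))
      (fun ω => (U i ω, V i ω)) P)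
    (hle : ∀ i a, ∫ ω, coordMax (a + U i ω) ∂P ≤ ∫ ω, symMax a (V i ω) ∂P) (a : K → ℝ) :
    2 ^ Fintype.card ι * ∫ ω, coordMax (a + ∑ i, U i ω) ∂P ≤
      ∑ σ : ι → ℤˣ, ∫ ω, coordMax (a + ∑ i, ((σ i : ℤ) : ℝ) • V i ω) ∂P := by
  -- Hybrid sums: the summands indexed by `s` have already been replaced by signed ones. The set `s`
  -- grows from empty to everything.
  let M (s : Finset ι) (σ : ι → ℤˣ) (i : ι) (ω : Ω) : K → ℝ :=
    if i ∈ s then ((σ i : ℤ) : ℝ) • V i ω else U i ω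
  have hM : ∀ s σ i, Integrable (M s σ i) P := by
    intro s σ i
    by_cases hi : i ∈ s
    · simp only [M, hi, if_true]; exact (hV i).smul ((σ i : ℤ) : ℝ)
    · simp only [M, hi, if_false]; exact hU i
  have key : ∀ s : Finset ι, 2 ^ Fintype.card ι * ∫ ω, coordMax (a + ∑ i, U i ω) ∂P ≤
      ∑ σ : ι → ℤˣ, ∫ ω, coordMax (a + ∑ i, M s σ i ω) ∂P := by
    intro s
    induction s using Finset.induction_on with
    | empty => simp [M]
    | insert i s his ih =>
      refine ih.trans ?_
      -- A replacement at `i` produces both signs of `V i`; pairing each `σ` with its flip at `i`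
      -- matches them with the sum over all sign patterns.
      let flip (σ : ι → ℤˣ) : ι → ℤˣ := Function.update σ i (-σ i)
      have hflip : Function.Involutive flip := fun σ => by simp [flip]
      let F (σ : ι → ℤˣ) : ℝ := ∫ ω, coordMax (a + ∑ i', M (insert i s) σ i' ω) ∂P
      have hsum : ∑ σ, F (flip σ) = ∑ σ, F σ := Equiv.sum_comp hflip.toPerm F
      have hstep : ∀ σ, ∫ ω, coordMax (a + ∑ i', M s σ i' ω) ∂P ≤ (F σ + F (flip σ)) / 2 := by
        intro σ
        let R (ω : Ω) : K → ℝ := a + ∑ i' : {i' // i' ≠ i}, M s σ i' ω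
        have hR : Integrable R P :=
          (integrable_const a).add (integrable_finsetSum _ fun i' _ => hM s σ i')
        have hind : IndepFun R (fun ω => (U i ω, V i ω)) P := by
          let g (t : {i' // i' ≠ i} → (K → ℝ) × (K → ℝ)) : K → ℝ :=
            a + ∑ i' : {i' // i' ≠ i},
              if (i' : ι) ∈ s then ((σ i' : ℤ) : ℝ) • (t i').2 else (t i').1
          have hg : Measurable g := by
            refine Measurable.const_add (Finset.measurable_sum _ fun i' _ => ?_) a
            split_ifs <;> fun_prop
          exact (h i).comp hg measurable_id
        have e1 : ∀ ω, a + ∑ i', M s σ i' ω = R ω + U i ω := by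
          intro ω
          simp only [R, Fintype.sum_eq_add_sum_subtype_ne _ i]
          simp only [M, his, if_false]
          abel
        have e2 : ∀ τ : ι → ℤˣ, (∀ i', i' ≠ i → τ i' = σ i') → ∀ ω,
            a + ∑ i', M (insert i s) τ i' ω = R ω + ((τ i : ℤ) : ℝ) • V i ω := by
          intro τ hτ ω
          simp only [R, Fintype.sum_eq_add_sum_subtype_ne _ i]
          have : ∑ i' : {i' // i' ≠ i}, M (insert i s) τ i' ω
              = ∑ i' : {i' // i' ≠ i}, M s σ i' ω := by
            refine Finset.sum_congr rfl fun i' _ => ?_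
            simp [M, Finset.mem_insert, i'.2, hτ i' i'.2]
          rw [this]
          simp only [M, Finset.mem_insert_self, if_true]
          abel
        have e3 := e2 σ fun _ _ => rfl
        have e4 := e2 (flip σ) fun i' hi' => by simp [flip, hi']
        have := integral_coordMax_add_le hR (hU i) (hV i) hind (hle i)
        simp only [F, e1, e3, e4]
        refine this.trans_eq ?_
        rcases Int.units_eq_one_or (σ i) with h1 | h1 <;> simp [flip, h1, sub_eq_add_neg, add_comm]
      calc _ ≤ ∑ σ, (F σ + F (flip σ)) / 2 := Finset.sum_le_sum fun σ _ => hstep σ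
        _ = ∑ σ, F σ := by
          rw [← Finset.sum_div, Finset.sum_add_distrib, hsum]; ring
  simpa [M] using key Finset.univ

end Symmetrization

/-! ### Symmetrization with one common sign per task -/

section TaskSymmetrization

variable {K : Type*} [Fintype K] [Nonempty K] {Ω : Type*} [MeasurableSpace Ω] {P : Measure Ω}
  [IsProbabilityMeasure P]

/-- Symmetrization and contraction for a single observation with losses `L` and outputs `F`. -/
lemma integral_coordMax_add_integral_sub_le {L F : Ω → K → ℝ} (hL : Integrable L P)
    (hF : Integrable F P) (hLF : ∀ ω k k', |L ω k - L ω k'| ≤ |F ω k - F ω k'|) (a : K → ℝ) :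
    ∫ ω, coordMax (a + (∫ ω', L ω' ∂P - L ω)) ∂P ≤ ∫ ω, symMax a ((2 : ℝ) • F ω) ∂P := by
  have h2L : Integrable (fun ω => (2 : ℝ) • L ω) P := hL.smul (2 : ℝ)
  have hp : Integrable (fun ω => a + (2 : ℝ) • L ω) P := (integrable_const a).add h2L
  have hm : Integrable (fun ω => a - (2 : ℝ) • L ω) P := (integrable_const a).sub h2L
  have hd : Integrable (fun ω => a + (∫ ω', L ω' ∂P - L ω)) P :=
    (integrable_const a).add ((integrable_const _).sub hL)
  set e := ∫ ω', L ω' ∂P with he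
  -- No ghost sample is needed: midpoint convexity separates the mean from the loss, and Jensen
  -- turns the mean back into a loss with the opposite sign.
  calc ∫ ω, coordMax (a + (e - L ω)) ∂P
      ≤ ∫ ω, (coordMax (a + (2 : ℝ) • e) + coordMax (a - (2 : ℝ) • L ω)) / 2 ∂P := by
        refine integral_mono (integrable_coordMax hd)
          (((integrable_const _).add (integrable_coordMax hm)).div_const 2) fun ω => ?_
        have := coordMax_add_add_le a e (-L ω)
        simpa only [smul_neg, ← sub_eq_add_neg] using this
    _ = (coordMax (a + (2 : ℝ) • e) + ∫ ω, coordMax (a - (2 : ℝ) • L ω) ∂P) / 2 := by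
        rw [integral_div, integral_add (integrable_const _) (integrable_coordMax hm)]
        simp
    _ ≤ ∫ ω, symMax a ((2 : ℝ) • L ω) ∂P := by
        rw [integral_symMax a h2L]
        have := coordMax_integral_le hp
        rw [integral_add (integrable_const a) h2L, integral_smul, ← he] at this
        simp only [integral_const, probReal_univ, one_smul] at this
        linarith
    _ ≤ ∫ ω, symMax a ((2 : ℝ) • F ω) ∂P := by
        refine integral_mono (integrable_symMax a h2L) (integrable_symMax a (hF.smul (2 : ℝ)))
          fun ω => symMax_le_of_abs_sub_le a fun k k' => ?_
        simp only [Pi.smul_apply, smul_eq_mul, ← mul_sub, abs_mul]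
        exact mul_le_mul_of_nonneg_left (hLF ω k k') (abs_nonneg _)

variable {J : Type*} [Fintype J] [DecidableEq J]

/-- A partial sum is dominated by the full sum, up to a factor `2`. -/
lemma integral_symMax_two_smul_sum_le {V : J → Ω → K → ℝ} (hV : ∀ j, Integrable (V j) P)
    (hind : iIndepFun V P) {w : K → ℝ} (hw : ∀ j, ∫ ω, V j ω ∂P = w) (a : K → ℝ)
    (s : Finset J) :
    ∫ ω, symMax a ((2 : ℝ) • ∑ j ∈ s, V j ω) ∂P ≤ ∫ ω, symMax a ((4 : ℝ) • ∑ j, V j ω) ∂P := by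
  have hsum : ∀ t : Finset J, Integrable (fun ω => (4 : ℝ) • ∑ j ∈ t, V j ω) P := fun t =>
    (integrable_finsetSum t fun j _ => hV j).smul (4 : ℝ)
  have hmean : ∀ t : Finset J, ∫ ω, (4 : ℝ) • ∑ j ∈ t, V j ω ∂P = (4 * (t.card : ℝ)) • w := by
    intro t
    rw [integral_smul, integral_finsetSum t fun j _ => hV j]
    simp only [hw, Finset.sum_const, mul_smul, Nat.cast_smul_eq_nsmul]
  have hI : IndepFun (fun ω => (4 : ℝ) • ∑ j ∈ s, V j ω) (fun ω => (4 : ℝ) • ∑ j ∈ sᶜ, V j ω) P := by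
    have h1 := hind.indepFun_finset₀ s sᶜ disjoint_compl_right fun j => (hV j).1.aemeasurable
    have h2 := h1.comp (φ := fun t => (4 : ℝ) • ∑ j, t j) (ψ := fun t => (4 : ℝ) • ∑ j, t j)
      (by fun_prop) (by fun_prop)
    convert h2 using 1
    · ext ω : 1; simp only [Function.comp]; rw [Finset.sum_coe_sort s (fun j => V j ω)]
    · ext ω : 1; simp only [Function.comp]; rw [Finset.sum_coe_sort sᶜ (fun j => V j ω)]
  -- `c • w` is the mean of four times the complementary sum. Jensen lets it stand in for that sum
  -- in `hJ1`, and by contraction it is dominated by the mean of four times the full sum in `hJ2`.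
  set c : ℝ := 4 * (sᶜ.card : ℝ) with hc
  have hJ1 := integral_symMax_add_integral_le a (hsum s) (hsum sᶜ) hI
  rw [hmean] at hJ1
  have hfull : ∀ ω, (4 : ℝ) • ∑ j ∈ s, V j ω + (4 : ℝ) • ∑ j ∈ sᶜ, V j ω
      = (4 : ℝ) • ∑ j, V j ω := fun ω => by
    rw [← smul_add, Finset.sum_add_sum_compl]
  simp only [hfull] at hJ1
  have hJ2 : symMax a (c • w) ≤ ∫ ω, symMax a ((4 : ℝ) • ∑ j, V j ω) ∂P := by
    refine le_trans ?_ (symMax_integral_le a (hsum Finset.univ))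
    rw [hmean]
    refine symMax_le_of_abs_sub_le a fun k k' => ?_
    simp only [Pi.smul_apply, smul_eq_mul, ← mul_sub, abs_mul]
    refine mul_le_mul_of_nonneg_right ?_ (abs_nonneg _)
    have : (sᶜ.card : ℝ) ≤ ((Finset.univ : Finset J).card : ℝ) := by
      exact_mod_cast Finset.card_le_univ _
    simp only [hc, abs_mul, Nat.abs_cast]
    exact mul_le_mul_of_nonneg_left this (abs_nonneg _)
  have hi1 : Integrable (fun ω => symMax a ((4 : ℝ) • ∑ j ∈ s, V j ω + c • w)) P :=
    integrable_symMax a ((hsum s).add (integrable_const _))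
  calc ∫ ω, symMax a ((2 : ℝ) • ∑ j ∈ s, V j ω) ∂P
      ≤ ∫ ω, (symMax a ((4 : ℝ) • ∑ j ∈ s, V j ω + c • w) + symMax a (c • w)) / 2 ∂P := by
        refine integral_mono (integrable_symMax a
          ((integrable_finsetSum s fun j _ => hV j).smul (2 : ℝ)))
          ((hi1.add (integrable_const _)).div_const 2) fun ω => ?_
        -- Half of `c • w` is added and subtracted, so that the doubling restores exactly `c • w` in
        -- both terms.
        have h1 := symMax_add_le a ((2 : ℝ) • ∑ j ∈ s, V j ω + (c / 2) • w) (-((c / 2) • w))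
        rw [add_neg_cancel_right, smul_neg, symMax_neg, smul_add, smul_smul, smul_smul] at h1
        norm_num at h1
        rw [mul_div_cancel₀ c two_ne_zero] at h1
        exact h1
    _ = (∫ ω, symMax a ((4 : ℝ) • ∑ j ∈ s, V j ω + c • w) ∂P + symMax a (c • w)) / 2 := by
        rw [integral_div, integral_add hi1 (integrable_const _)]
        simp
    _ ≤ _ := by linarith

/-- Individual signs are dominated by a common sign, up to a factor `4`. -/
lemma integral_symMax_signed_sum_le {V : J → Ω → K → ℝ} (hV : ∀ j, Integrable (V j) P)
    (hind : iIndepFun V P) {w : K → ℝ} (hw : ∀ j, ∫ ω, V j ω ∂P = w) (a : K → ℝ)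
    (ε : J → ℤˣ) :
    ∫ ω, symMax a (∑ j, ((ε j : ℤ) : ℝ) • V j ω) ∂P ≤
      ∫ ω, symMax a ((4 : ℝ) • ∑ j, V j ω) ∂P := by
  -- Positive and negative signs form two blocks; evenness of `symMax a` removes the minus sign of
  -- the second.
  let s : Finset J := Finset.univ.filter fun j => ε j = 1
  have hsplit : ∀ ω, ∑ j, ((ε j : ℤ) : ℝ) • V j ω = ∑ j ∈ s, V j ω + -∑ j ∈ sᶜ, V j ω := by
    intro ω
    rw [← Finset.sum_add_sum_compl s, ← Finset.sum_neg_distrib]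
    congr 1
    · refine Finset.sum_congr rfl fun j hj => ?_
      have : ε j = 1 := by simpa [s] using hj
      simp [this]
    · refine Finset.sum_congr rfl fun j hj => ?_
      have : ε j = -1 := (Int.units_eq_one_or (ε j)).resolve_left (by simpa [s] using hj)
      simp [this]
  have hi : ∀ t : Finset J, Integrable (fun ω => symMax a ((2 : ℝ) • ∑ j ∈ t, V j ω)) P := fun t =>
    integrable_symMax a ((integrable_finsetSum t fun j _ => hV j).smul (2 : ℝ))
  calc ∫ ω, symMax a (∑ j, ((ε j : ℤ) : ℝ) • V j ω) ∂P
      ≤ ∫ ω, (symMax a ((2 : ℝ) • ∑ j ∈ s, V j ω)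
          + symMax a ((2 : ℝ) • ∑ j ∈ sᶜ, V j ω)) / 2 ∂P := by
        refine integral_mono (integrable_symMax a (integrable_finsetSum _ fun j _ =>
          (hV j).smul ((ε j : ℤ) : ℝ))) (((hi s).add (hi sᶜ)).div_const 2) fun ω => ?_
        have h1 := symMax_add_le a (∑ j ∈ s, V j ω) (-∑ j ∈ sᶜ, V j ω)
        rw [smul_neg, symMax_neg] at h1
        simpa only [hsplit ω] using h1
    _ = (∫ ω, symMax a ((2 : ℝ) • ∑ j ∈ s, V j ω) ∂P
          + ∫ ω, symMax a ((2 : ℝ) • ∑ j ∈ sᶜ, V j ω) ∂P) / 2 := by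
        rw [integral_div, integral_add (hi s) (hi sᶜ)]
    _ ≤ _ := by
        have h1 := integral_symMax_two_smul_sum_le hV hind hw a s
        have h2 := integral_symMax_two_smul_sum_le hV hind hw a sᶜ
        linarith

/-- Symmetrization and contraction for a task: the deviations of the losses `L j` are dominated by
the sum of the outputs `F j` with one common sign. -/
theorem integral_coordMax_add_sum_le {L F : J → Ω → K → ℝ} (hL : ∀ j, Integrable (L j) P)
    (hF : ∀ j, Integrable (F j) P) (hind : iIndepFun (fun j ω => (L j ω, F j ω)) P)
    (hLF : ∀ j ω k k', |L j ω k - L j ω k'| ≤ |F j ω k - F j ω k'|)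
    {w : K → ℝ} (hw : ∀ j, ∫ ω, F j ω ∂P = w) (a : K → ℝ) :
    ∫ ω, coordMax (a + ∑ j, (∫ ω', L j ω' ∂P - L j ω)) ∂P ≤
      ∫ ω, symMax a ((8 : ℝ) • ∑ j, F j ω) ∂P := by
  have hU : ∀ j, Integrable (fun ω => ∫ ω', L j ω' ∂P - L j ω) P := fun j =>
    (integrable_const _).sub (hL j)
  have hV : ∀ j, Integrable (fun ω => (2 : ℝ) • F j ω) P := fun j => (hF j).smul (2 : ℝ)
  have hUV : iIndepFun (fun j ω => (∫ ω', L j ω' ∂P - L j ω, (2 : ℝ) • F j ω)) P :=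
    hind.comp (fun j p => (∫ ω', L j ω' ∂P - p.1, (2 : ℝ) • p.2)) fun j => by fun_prop
  have h1 := integral_coordMax_sum_le hU hV (fun j => ?_)
    (fun j a => integral_coordMax_add_integral_sub_le (hL j) (hF j) (hLF j) a) a
  · set G : (J → ℤˣ) → ℝ := fun ε =>
      ∫ ω, coordMax (a + ∑ j, ((ε j : ℤ) : ℝ) • (2 : ℝ) • F j ω) ∂P with hG
    -- Averaging `ε` with `-ε` turns the sum of the `G ε` into expectations of `symMax a`, to which
    -- the common-sign bound applies.
    have hneg : ∑ ε, G (-ε) = ∑ ε, G ε := Equiv.sum_comp (Equiv.neg _) G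
    have h2 : ∀ ε, (G ε + G (-ε)) / 2 ≤ ∫ ω, symMax a ((8 : ℝ) • ∑ j, F j ω) ∂P := by
      intro ε
      have h3 := integral_symMax_signed_sum_le (w := (2 : ℝ) • w) hV
        (hUV.comp (fun j p => p.2) fun j => measurable_snd)
        (fun j => by rw [integral_smul, hw]) a ε
      have hs : Integrable (fun ω => ∑ j, ((ε j : ℤ) : ℝ) • (2 : ℝ) • F j ω) P :=
        integrable_finsetSum _ fun j _ => (hV j).smul ((ε j : ℤ) : ℝ)
      rw [integral_symMax a hs] at h3
      have e1 : G (-ε) = ∫ ω, coordMax (a - ∑ j, ((ε j : ℤ) : ℝ) • (2 : ℝ) • F j ω) ∂P := by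
        simp [hG, sub_eq_add_neg]
      -- 8 = 4 · 2: common sign times symmetrization of single observations.
      have e2 : ∀ ω, (4 : ℝ) • ∑ j, (2 : ℝ) • F j ω = (8 : ℝ) • ∑ j, F j ω := fun ω => by
        rw [← Finset.smul_sum, smul_smul]; norm_num
      simp only [e2] at h3
      rw [e1]
      exact h3
    have h4 : ∑ ε, G ε ≤ 2 ^ Fintype.card J * ∫ ω, symMax a ((8 : ℝ) • ∑ j, F j ω) ∂P := by
      calc ∑ ε, G ε = ∑ ε, (G ε + G (-ε)) / 2 := by
            rw [← Finset.sum_div, Finset.sum_add_distrib, hneg]; ring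
        _ ≤ ∑ _ε : J → ℤˣ, ∫ ω, symMax a ((8 : ℝ) • ∑ j, F j ω) ∂P :=
            Finset.sum_le_sum fun ε _ => h2 ε
        _ = _ := by simp
    exact le_of_mul_le_mul_left (h1.trans h4) (by positivity)
  · exact (indepFun_of_disjoint_range hUV
      (fun i => (hU i).1.aemeasurable.prodMk (hV i).1.aemeasurable)
      (fun i' : {i' // i' ≠ j} => (i' : J)) (fun _ : Unit => j) fun k _ => k.2).comp
      measurable_id (measurable_pi_apply ())

end TaskSymmetrization

/-! ### Concentration by bounded differences -/

section BoundedDifferences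

variable {E : Type*} [NormedAddCommGroup E]

lemma lipschitz_mem_Icc {H : E → ℝ} (hH : LipschitzWith 1 H) {x y : E} {c : ℝ} (hy : ‖y‖ ≤ c) :
    H (x + y) ∈ Set.Icc (H x - c) (H x + c) := by
  have h := hH.dist_le_mul (x + y) x
  rw [Real.dist_eq, dist_eq_norm, add_sub_cancel_left, NNReal.coe_one, one_mul] at h
  have := abs_le.1 (h.trans hy)
  constructor <;> linarith

variable [MeasurableSpace E] [BorelSpace E] [SecondCountableTopology E]
  {Ω : Type*} [MeasurableSpace Ω] {P : Measure Ω} [IsProbabilityMeasure P]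

/-- **Bounded differences inequality** for a Lipschitz function of a sum of independent vectors in
the unit ball. -/
theorem hasSubgaussianMGF_lipschitz_sum {ι : Type*} {X : ι → Ω → E}
    (hX : ∀ i, AEMeasurable (X i) P) (hb : ∀ i ω, ‖X i ω‖ ≤ 1) (hind : iIndepFun X P)
    (s : Finset ι) :
    ∀ {H : E → ℝ}, LipschitzWith 1 H →
      HasSubgaussianMGF (fun ω => H (∑ i ∈ s, X i ω) - ∫ ω', H (∑ i ∈ s, X i ω') ∂P)
        (s.card : ℝ≥0) P := by
  classical
  induction s using Finset.induction_on with
  | empty =>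
    intro H _
    simp
  | insert i s his ih =>
    intro H hH
    have hHm : Measurable H := hH.continuous.measurable
    have hsm : ∀ t : Finset ι, AEMeasurable (fun ω => ∑ j ∈ t, X j ω) P := fun t =>
      Finset.aemeasurable_fun_sum t fun j _ => hX j
    have hsb : ∀ (t : Finset ι) ω, ‖∑ j ∈ t, X j ω‖ ≤ t.card := fun t ω => by
      simpa using norm_sum_le_of_le t fun j _ => hb j ω
    let Y (ω : Ω) : E := ∑ j ∈ s, X j ω
    have hYX : IndepFun Y (X i) P := by
      have := hind.indepFun_finsetSum_of_notMem₀ hX his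
      have e : (∑ j ∈ s, X j) = Y := by ext ω; simp [Y]
      rwa [e] at this
    have hshift : ∀ y, Integrable (fun ω => H (y + X i ω)) P := fun y =>
      Integrable.of_mem_Icc _ _ (hHm.comp_aemeasurable ((hX i).const_add y))
        (ae_of_all _ fun ω => lipschitz_mem_Icc hH (hb i ω))
    -- Averaging out the last vector keeps the Lipschitz constant 1, so the induction hypothesis,
    -- stated for all such functions, applies to `H₁`. By `hmean` below the centring constant does
    -- not change.
    let H₁ (y : E) : ℝ := ∫ ω, H (y + X i ω) ∂P
    have hH₁ : LipschitzWith 1 H₁ := by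
      refine LipschitzWith.of_le_add fun x y => ?_
      calc ∫ ω, H (x + X i ω) ∂P ≤ ∫ ω, (H (y + X i ω) + dist x y) ∂P := by
            refine integral_mono (hshift x) ((hshift y).add (integrable_const _)) fun ω => ?_
            have h := hH.dist_le_mul (x + X i ω) (y + X i ω)
            rw [Real.dist_eq, dist_add_right, NNReal.coe_one, one_mul] at h
            have := le_abs_self (H (x + X i ω) - H (y + X i ω))
            dsimp only
            linarith
        _ = H₁ y + dist x y := by
            rw [integral_add (hshift y) (integrable_const _)]
            simp [H₁]
    have hsum : ∀ ω, ∑ j ∈ insert i s, X j ω = Y ω + X i ω := fun ω => by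
      rw [Finset.sum_insert his, add_comm]
    have hYm : AEMeasurable Y P := hsm s
    have hZm : AEMeasurable (fun ω => H (Y ω + X i ω)) P :=
      hHm.comp_aemeasurable (hYm.add (hX i))
    have hZb : ∀ᵐ ω ∂P, H (Y ω + X i ω) ∈
        Set.Icc (H 0 - (insert i s).card) (H 0 + (insert i s).card) := ae_of_all _ fun ω => by
      have := lipschitz_mem_Icc hH (x := 0) (hsb (insert i s) ω)
      rwa [zero_add, hsum] at this
    have hZi : Integrable (fun ω => H (Y ω + X i ω)) P := Integrable.of_mem_Icc _ _ hZm hZb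
    have hmean : ∫ ω, H (Y ω + X i ω) ∂P = ∫ ω, H₁ (Y ω) ∂P :=
      integral_eq_integral_integral_of_indepFun hYm (hX i) hYX
        (φ := fun p => H (p.1 + p.2)) (hHm.comp (measurable_fst.add measurable_snd)) hZi
    simp only [hsum]
    set e := ∫ ω, H (Y ω + X i ω) ∂P with he
    have hexp : ∀ t : ℝ, Integrable (fun ω => Real.exp (t * (H (Y ω + X i ω) - e))) P := fun t =>
      integrable_exp_mul_of_mem_Icc (hZm.sub_const e) (hZb.mono fun ω h =>
        (⟨sub_le_sub_right h.1 e, sub_le_sub_right h.2 e⟩ :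
          H (Y ω + X i ω) - e ∈ Set.Icc (H 0 - (insert i s).card - e)
            (H 0 + (insert i s).card - e)))
    refine ⟨hexp, fun t => ?_⟩
    have hIH := ih hH₁
    rw [← hmean] at hIH
    have hφ : Measurable fun p : E × E => Real.exp (t * (H (p.1 + p.2) - e)) := by fun_prop
    have hcond : ∀ y, ∫ ω, Real.exp (t * (H (y + X i ω) - e)) ∂P ≤
        Real.exp (t * (H₁ y - e)) * Real.exp (t ^ 2 / 2) := by
      intro y
      have h1 := (hasSubgaussianMGF_of_mem_Icc
        (hHm.comp_aemeasurable ((hX i).const_add y) : AEMeasurable (fun ω => H (y + X i ω)) P)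
        (ae_of_all _ fun ω => lipschitz_mem_Icc hH (hb i ω))).mgf_le t
      -- For fixed `y` the values lie in an interval of length 2, so Hoeffding's lemma adds variance
      -- proxy 1 per vector.
      have h2 : (((‖H y + 1 - (H y - 1)‖₊ / 2) ^ 2 : ℝ≥0) : ℝ) = 1 := by
        have : H y + 1 - (H y - 1) = 2 := by ring
        rw [this]; simp
      rw [h2, one_mul, mgf] at h1
      calc ∫ ω, Real.exp (t * (H (y + X i ω) - e)) ∂P
          = Real.exp (t * (H₁ y - e)) * ∫ ω, Real.exp (t * (H (y + X i ω) - H₁ y)) ∂P := by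
            rw [← integral_const_mul]
            refine integral_congr_ae (ae_of_all _ fun ω => ?_)
            dsimp only
            rw [← Real.exp_add]; ring_nf
        _ ≤ _ := mul_le_mul_of_nonneg_left h1 (Real.exp_nonneg _)
    calc mgf (fun ω => H (Y ω + X i ω) - e) P t
        = ∫ ω, ∫ ω', Real.exp (t * (H (Y ω + X i ω') - e)) ∂P ∂P :=
          integral_eq_integral_integral_of_indepFun hYm (hX i) hYX hφ (hexp t)
      _ ≤ ∫ ω, Real.exp (t * (H₁ (Y ω) - e)) * Real.exp (t ^ 2 / 2) ∂P :=
          integral_mono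
            (integrable_prod_of_indepFun hYm (hX i) hYX hφ (hexp t)).integral_prod_left
            ((hIH.integrable_exp_mul t).mul_const _) fun ω => hcond (Y ω)
      _ = mgf (fun ω => H₁ (Y ω) - e) P t * Real.exp (t ^ 2 / 2) := integral_mul_const _ _
      _ ≤ Real.exp ((s.card : ℝ≥0) * t ^ 2 / 2) * Real.exp (t ^ 2 / 2) :=
          mul_le_mul_of_nonneg_right (hIH.mgf_le t) (Real.exp_nonneg _)
      _ = Real.exp (((insert i s).card : ℝ≥0) * t ^ 2 / 2) := by
          rw [← Real.exp_add, Finset.card_insert_of_notMem his]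
          push_cast
          ring_nf

end BoundedDifferences

/-- By Fubini on the product space, for almost every frozen value of `B` the sum is integrable in
`A` alone, and `B` is then a constant. -/
lemma integrable_left_of_integrable_add {Ω : Type*} [MeasurableSpace Ω] {P : Measure Ω}
    [IsProbabilityMeasure P] {A B : Ω → ℝ} (hA : AEMeasurable A P) (hB : AEMeasurable B P)
    (h : IndepFun A B P) (hi : Integrable (fun ω => A ω + B ω) P) : Integrable A P := by
  have h1 := integrable_prod_of_indepFun hA hB h (φ := fun p => p.1 + p.2) (by fun_prop) hi
  obtain ⟨ω, hω⟩ := h1.prod_left_ae.exists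
  exact (hω.sub (integrable_const (B ω))).congr (ae_of_all _ fun ω' => by simp)

/-! ### Integrability of outputs and bounds on risks -/

section Learning

variable {X Y Ω Param : Type*} {m n : ℕ}

lemma signedSum_neg (f : Fin m → X → Param → ℝ) (D : Fin m → Fin n → X × Y) (σ : Fin m → ℤˣ)
    (Θ : Param) : signedSum f D (-σ) Θ = -signedSum f D σ Θ := by
  simp [signedSum, neg_div]

lemma sum_signedSum (f : Fin m → X → Param → ℝ) (D : Fin m → Fin n → X × Y) (Θ : Param) :
    ∑ σ : Fin m → ℤˣ, signedSum f D σ Θ = 0 := by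
  have h : ∑ σ : Fin m → ℤˣ, signedSum f D (-σ) Θ = ∑ σ : Fin m → ℤˣ, signedSum f D σ Θ :=
    Equiv.sum_comp (Equiv.neg _) fun σ => signedSum f D σ Θ
  simp only [signedSum_neg, Finset.sum_neg_distrib] at h
  linarith

/-- Each supremum dominates the value at one fixed parameter, and those values cancel when summed
over all signs. -/
lemma rademacherComplexity_nonneg [MeasurableSpace Ω] {P : Measure Ω}
    {f : Fin m → X → Param → ℝ} {C : Set Param} (hC : C.Nonempty) {S : Fin m → Fin n → Ω → X × Y}
    (hrad : HasRademacherComplexity P f C S) : 0 ≤ rademacherComplexity P f C S := by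
  obtain ⟨Θ, hΘ⟩ := hC
  refine integral_nonneg_of_ae ?_
  filter_upwards [ae_all_iff.2 fun σ => (hrad σ).1] with ω hω
  refine mul_nonneg (by positivity) ?_
  rw [← sum_signedSum f (fun i j => S i j ω) Θ]
  exact Finset.sum_le_sum fun σ _ => le_csSup (hω σ) (Set.mem_image_of_mem _ hΘ)

variable [MeasurableSpace X] [MeasurableSpace Y] [MeasurableSpace Ω] {P : Measure Ω}
  [IsProbabilityMeasure P] {μ : Fin m → Measure (X × Y)} {S : Fin m → Fin n → Ω → X × Y}
  {f : Fin m → X → Param → ℝ} {C : Set Param}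

/-- The outputs `f_i(x_{ij}; Θ)` are integrable as soon as the Rademacher complexity is defined. -/
lemma integrable_output (hm : 0 < m) (hn : 0 < n) (hS : ∀ i j, AEMeasurable (S i j) P)
    (hS_indep : iIndepFun (fun p : Fin m × Fin n => S p.1 p.2) P)
    (hf : ∀ i Θ, Measurable (fun x => f i x Θ)) (hrad : HasRademacherComplexity P f C S)
    {Θ : Param} (hΘ : Θ ∈ C) (i : Fin m) (j : Fin n) :
    Integrable (fun ω => f i (S i j ω).1 Θ) P := by
  have hmeas : ∀ i j, AEMeasurable (fun ω => f i (S i j ω).1 Θ) P := fun i j =>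
    (hf i Θ).comp_aemeasurable (measurable_fst.comp_aemeasurable (hS i j))
  have hsum_meas : ∀ i, AEMeasurable (fun ω => ∑ j, f i (S i j ω).1 Θ) P := fun i =>
    Finset.aemeasurable_fun_sum _ fun j _ => hmeas i j
  have hsigned : ∀ σ, Integrable (fun ω => signedSum f (fun i j => S i j ω) σ Θ) P := by
    intro σ
    -- The supremum for `σ` bounds the signed sum from above; the one for `-σ` bounds it from below.
    refine ((hrad σ).2.abs.add (hrad (-σ)).2.abs).mono' ?_ ?_
    · exact (Finset.aemeasurable_fun_sum _ fun i _ =>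
        (hsum_meas i).const_mul _).aestronglyMeasurable
    · filter_upwards [(hrad σ).1, (hrad (-σ)).1] with ω h1 h2
      have h3 := le_csSup h1 (Set.mem_image_of_mem _ hΘ)
      have h4 := le_csSup h2 (Set.mem_image_of_mem _ hΘ)
      rw [signedSum_neg] at h4
      change _ ≤ signedSup f C (fun i j => S i j ω) σ at h3
      change _ ≤ signedSup f C (fun i j => S i j ω) (-σ) at h4
      rw [Real.norm_eq_abs, abs_le, Pi.add_apply]
      have h5 := le_abs_self (signedSup f C (fun i j => S i j ω) σ)
      have h6 := le_abs_self (signedSup f C (fun i j => S i j ω) (-σ))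
      have h7 := abs_nonneg (signedSup f C (fun i j => S i j ω) σ)
      have h8 := abs_nonneg (signedSup f C (fun i j => S i j ω) (-σ))
      constructor <;> linarith
  have htask : Integrable (fun ω => ∑ j, f i (S i j ω).1 Θ) P := by
    -- Two sign patterns that differ only at `i` isolate task `i`, with coefficient `2 / (n m)`.
    have h1 := ((hsigned 1).sub (hsigned (Function.update 1 i (-1)))).const_mul
      ((n : ℝ) * (m : ℝ) / 2)
    refine h1.congr (ae_of_all _ fun ω => ?_)
    have hm' : (m : ℝ) ≠ 0 := by positivity
    have hn' : (n : ℝ) ≠ 0 := by positivity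
    simp only [Pi.sub_apply, signedSum, ← Finset.sum_sub_distrib]
    rw [Finset.sum_eq_single i]
    · simp; field_simp; ring
    · intro i' _ hi'
      simp [hi']
    · simp
  classical
  have hsplit : ∀ ω, ∑ j', f i (S i j' ω).1 Θ
      = f i (S i j ω).1 Θ + ∑ j' : {j' // j' ≠ j}, f i (S i j' ω).1 Θ := fun ω =>
    Fintype.sum_eq_add_sum_subtype_ne _ j
  simp only [hsplit] at htask
  refine integrable_left_of_integrable_add (hmeas i j)
    (Finset.aemeasurable_fun_sum _ fun (j' : {j' // j' ≠ j}) _ => hmeas i j') ?_ htask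
  have h1 := indepFun_of_disjoint_range hS_indep (fun p => hS p.1 p.2) (fun _ : Unit => (i, j))
    (fun j' : {j' // j' ≠ j} => (i, (j' : Fin n))) (fun _ j' h => j'.2 (Prod.ext_iff.1 h).2.symm)
  have hg : Measurable fun t : {j' // j' ≠ j} → X × Y => ∑ j', f i (t j').1 Θ :=
    Finset.measurable_sum _ fun j' _ =>
      (hf i Θ).comp (measurable_fst.comp (measurable_pi_apply j'))
  have hg' : Measurable fun t : Unit → X × Y => f i (t ()).1 Θ :=
    (hf i Θ).comp (measurable_fst.comp (measurable_pi_apply ()))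
  exact h1.comp hg' hg

variable {l : ℝ → Y → ℝ} {ρ : ℝ≥0}

lemma measurable_loss (hf : ∀ i Θ, Measurable (fun x => f i x Θ))
    (hl : Measurable (Function.uncurry l)) (i : Fin m) (Θ : Param) :
    Measurable fun z : X × Y => l (f i z.1 Θ) z.2 :=
  hl.comp (((hf i Θ).comp measurable_fst).prodMk measurable_snd)

lemma taskRisk_mem_Icc [∀ i, IsProbabilityMeasure (μ i)]
    (hf : ∀ i Θ, Measurable (fun x => f i x Θ)) (hl : Measurable (Function.uncurry l))
    (hl_range : ∀ a y, l a y ∈ Set.Icc (0 : ℝ) 1) (i : Fin m) (Θ : Param) :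
    taskRisk l f μ i Θ ∈ Set.Icc (0 : ℝ) 1 := by
  refine ⟨integral_nonneg fun z => (hl_range _ _).1, ?_⟩
  have h : Integrable (fun z : X × Y => l (f i z.1 Θ) z.2) (μ i) :=
    Integrable.of_mem_Icc 0 1 (measurable_loss hf hl i Θ).aemeasurable
      (ae_of_all _ fun z => hl_range _ _)
  calc taskRisk l f μ i Θ ≤ ∫ _, (1 : ℝ) ∂(μ i) :=
        integral_mono h (integrable_const _) fun z => (hl_range _ _).2
    _ = 1 := by simp

/-! ### Uniform deviations over a finite subclass -/

section FiniteClass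

variable {K : Type*} {θ : K → Param}

/-- The vector of deviations of the losses at one data point from their expectations. -/
noncomputable def deviation (l : ℝ → Y → ℝ) (f : Fin m → X → Param → ℝ)
    (μ : Fin m → Measure (X × Y)) (θ : K → Param) (i : Fin m) (z : X × Y) : K → ℝ :=
  fun k => taskRisk l f μ i (θ k) - l (f i z.1 (θ k)) z.2

/-- The gap between the average risk and its empirical version. -/
noncomputable def riskGap (l : ℝ → Y → ℝ) (f : Fin m → X → Param → ℝ)
    (μ : Fin m → Measure (X × Y)) (D : Fin m → Fin n → X × Y) (Θ : Param) : ℝ :=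
  averageRisk l f μ Θ - (1 / (m : ℝ)) * ∑ i, empiricalTaskRisk l f D i Θ

lemma sum_deviation_apply (hm : 0 < m) (hn : 0 < n) (D : Fin m → Fin n → X × Y) (k : K) :
    (∑ i, ∑ j, deviation l f μ θ i (D i j)) k = n * m * riskGap l f μ D (θ k) := by
  have hm' : (m : ℝ) ≠ 0 := by positivity
  have hn' : (n : ℝ) ≠ 0 := by positivity
  simp only [Finset.sum_apply, deviation, Finset.sum_sub_distrib, riskGap, averageRisk,
    empiricalTaskRisk, Finset.sum_const, Finset.card_univ, Fintype.card_fin, nsmul_eq_mul,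
    ← Finset.mul_sum]
  field_simp

variable [Fintype K] [Nonempty K]

/-- The expected uniform deviation over a finite subclass is at most `8 ρ` times the Rademacher
complexity. -/
theorem integral_coordMax_deviation_le (hm : 0 < m) (hn : 0 < n)
    (hS_law : ∀ i j, HasLaw (S i j) (μ i) P)
    (hS_indep : iIndepFun (fun p : Fin m × Fin n => S p.1 p.2) P)
    (hf : ∀ i Θ, Measurable (fun x => f i x Θ)) (hl : Measurable (Function.uncurry l))
    (hl_range : ∀ a y, l a y ∈ Set.Icc (0 : ℝ) 1)
    (hl_lip : ∀ y, LipschitzWith ρ (fun a => l a y)) (hrad : HasRademacherComplexity P f C S)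
    (hθ : ∀ k, θ k ∈ C) :
    ∫ ω, coordMax (∑ i, ∑ j, deviation l f μ θ i (S i j ω)) ∂P ≤
      8 * ρ * (n * m) * rademacherComplexity P f C S := by
  have hS : ∀ i j, AEMeasurable (S i j) P := fun i j => (hS_law i j).aemeasurable
  let lossVec (i : Fin m) (z : X × Y) : K → ℝ := fun k => l (f i z.1 (θ k)) z.2
  -- Scaling the outputs by `ρ` reduces the Lipschitz hypothesis to a contraction with constant 1.
  let outVec (i : Fin m) (z : X × Y) : K → ℝ := fun k => ρ * f i z.1 (θ k)
  have hlv : ∀ i, Measurable (lossVec i) := fun i =>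
    measurable_pi_lambda _ fun k => measurable_loss hf hl i (θ k)
  have hov : ∀ i, Measurable (outVec i) := fun i =>
    measurable_pi_lambda _ fun k => ((hf i (θ k)).comp measurable_fst).const_mul _
  let L (i : Fin m) (j : Fin n) (ω : Ω) : K → ℝ := lossVec i (S i j ω)
  let F (i : Fin m) (j : Fin n) (ω : Ω) : K → ℝ := outVec i (S i j ω)
  have hL : ∀ i j, Integrable (L i j) P := fun i j =>
    Integrable.of_eval fun k => Integrable.of_mem_Icc 0 1
      ((measurable_loss hf hl i (θ k)).comp_aemeasurable (hS i j))
      (ae_of_all _ fun ω => hl_range _ _)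
  have hF : ∀ i j, Integrable (F i j) P := fun i j => Integrable.of_eval fun k =>
    (integrable_output hm hn hS hS_indep hf hrad (hθ k) i j).const_mul _
  have hLF : ∀ i j ω k k', |L i j ω k - L i j ω k'| ≤ |F i j ω k - F i j ω k'| := by
    intro i j ω k k'
    have h := (hl_lip (S i j ω).2).dist_le_mul (f i (S i j ω).1 (θ k)) (f i (S i j ω).1 (θ k'))
    rw [Real.dist_eq, Real.dist_eq] at h
    refine h.trans_eq ?_
    simp only [F, outVec, ← mul_sub, abs_mul, NNReal.abs_eq]
  have hmean : ∀ i j, ∫ ω, L i j ω ∂P = fun k => taskRisk l f μ i (θ k) := by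
    intro i j
    ext k
    rw [eval_integral fun k => (hL i j).eval k]
    exact (hS_law i j).integral_comp (measurable_loss hf hl i (θ k)).aestronglyMeasurable
  have hdev : ∀ i j ω, deviation l f μ θ i (S i j ω) = ∫ ω', L i j ω' ∂P - L i j ω := by
    intro i j ω
    rw [hmean]
    rfl
  have htask := fun i => integral_coordMax_add_sum_le (hL i) (hF i)
    ((hS_indep.precomp (g := fun j => (i, j)) fun j j' h => (Prod.ext_iff.1 h).2).comp
      (fun _ z => (lossVec i z, outVec i z)) fun _ => (hlv i).prodMk (hov i)) (hLF i)
    -- The common mean required within a task exists because all its observations have law `μ i`.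
    (w := ∫ z, outVec i z ∂(μ i))
    (fun j => (hS_law i j).integral_comp (hov i).aestronglyMeasurable)
  have hU : ∀ i, Integrable (fun ω => ∑ j, (∫ ω', L i j ω' ∂P - L i j ω)) P := fun i =>
    integrable_finsetSum _ fun j _ => (integrable_const _).sub (hL i j)
  have hV : ∀ i, Integrable (fun ω => (8 : ℝ) • ∑ j, F i j ω) P := fun i =>
    (integrable_finsetSum _ fun j _ => hF i j).smul (8 : ℝ)
  have hsign := integral_coordMax_sum_le hU hV (fun i => ?_) htask 0
  · simp only [hdev, zero_add, Fintype.card_fin] at hsign ⊢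
    have hb : ∀ σ : Fin m → ℤˣ,
        ∫ ω, coordMax (∑ i, ((σ i : ℤ) : ℝ) • (8 : ℝ) • ∑ j, F i j ω) ∂P ≤
          8 * ρ * (n * m) * ∫ ω, signedSup f C (fun i j => S i j ω) σ ∂P := by
      intro σ
      rw [← integral_const_mul]
      refine integral_mono_ae (integrable_coordMax (integrable_finsetSum _ fun i _ =>
        (hV i).smul ((σ i : ℤ) : ℝ))) ((hrad σ).2.const_mul _) ?_
      filter_upwards [(hrad σ).1] with ω hω
      refine coordMax_le fun k => ?_
      have h1 := le_csSup hω (Set.mem_image_of_mem _ (hθ k))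
      refine le_trans (le_of_eq ?_) (mul_le_mul_of_nonneg_left h1
        (by positivity : (0 : ℝ) ≤ 8 * ρ * (n * m)))
      simp only [signedSum, Finset.sum_apply, Pi.smul_apply, smul_eq_mul, F, outVec,
        ← Finset.mul_sum]
      rw [Finset.mul_sum]
      refine Finset.sum_congr rfl fun i _ => ?_
      have hm' : (m : ℝ) ≠ 0 := by positivity
      have hn' : (n : ℝ) ≠ 0 := by positivity
      field_simp
    have h2 := hsign.trans (Finset.sum_le_sum fun σ _ => hb σ)
    rw [← Finset.mul_sum, ← integral_finsetSum _ fun σ _ => (hrad σ).2] at h2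
    rw [rademacherComplexity, integral_const_mul]
    have h3 : (0 : ℝ) < 2 ^ m := by positivity
    rw [← mul_le_mul_iff_right₀ h3]
    refine h2.trans_eq ?_
    field_simp
  · have h1 := indepFun_of_disjoint_range hS_indep (fun p => hS p.1 p.2)
      (fun q : {i' // i' ≠ i} × Fin n => ((q.1 : Fin m), q.2)) (fun j : Fin n => (i, j))
      (fun q _ h => q.1.2 (Prod.ext_iff.1 h).1)
    let g (i : Fin m) (t : Fin n → X × Y) : (K → ℝ) × (K → ℝ) :=
      (∑ j, (∫ ω', L i j ω' ∂P - lossVec i (t j)), (8 : ℝ) • ∑ j, outVec i (t j))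
    have hg : ∀ i, Measurable (g i) := fun i => by
      have := hlv i
      have := hov i
      fun_prop
    have hg' : Measurable fun (t : {i' // i' ≠ i} × Fin n → X × Y) (i' : {i' // i' ≠ i}) =>
        g i' fun j => t (i', j) :=
      measurable_pi_lambda _ fun i' => (hg i').comp
        (measurable_pi_lambda _ fun j => measurable_pi_apply _)
    exact h1.comp hg' (hg i)

/-- Uniform deviation bound over a finite subclass. -/
theorem measure_exists_riskGap_le [∀ i, IsProbabilityMeasure (μ i)] (hm : 0 < m) (hn : 0 < n)
    (hS_law : ∀ i j, HasLaw (S i j) (μ i) P)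
    (hS_indep : iIndepFun (fun p : Fin m × Fin n => S p.1 p.2) P)
    (hf : ∀ i Θ, Measurable (fun x => f i x Θ)) (hl : Measurable (Function.uncurry l))
    (hl_range : ∀ a y, l a y ∈ Set.Icc (0 : ℝ) 1)
    (hl_lip : ∀ y, LipschitzWith ρ (fun a => l a y)) (hrad : HasRademacherComplexity P f C S)
    (hθ : ∀ k, θ k ∈ C) {ε : ℝ} (hε : 0 ≤ ε) :
    P.real {ω | ∃ k, 8 * ρ * rademacherComplexity P f C S + ε <
        riskGap l f μ (fun i j => S i j ω) (θ k)} ≤ Real.exp (-(m * n * ε ^ 2 / 2)) := by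
  have hdm : ∀ i, Measurable (deviation l f μ θ i) := fun i =>
    measurable_pi_lambda _ fun k => (measurable_loss hf hl i (θ k)).const_sub _
  have hdb : ∀ i z, ‖deviation l f μ θ i z‖ ≤ 1 := by
    intro i z
    -- Risk and loss both lie in [0,1], so their difference has absolute value at most 1.
    refine (pi_norm_le_iff_of_nonneg zero_le_one).2 fun k => ?_
    have h1 := taskRisk_mem_Icc (μ := μ) hf hl hl_range i (θ k)
    have h2 := hl_range (f i z.1 (θ k)) z.2
    rw [Real.norm_eq_abs, deviation, abs_le]
    constructor <;> linarith [h1.1, h1.2, h2.1, h2.2]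
  have hsub := hasSubgaussianMGF_lipschitz_sum
    (X := fun (p : Fin m × Fin n) ω => deviation l f μ θ p.1 (S p.1 p.2 ω))
    (fun p => (hdm p.1).comp_aemeasurable (hS_law p.1 p.2).aemeasurable)
    (fun p ω => hdb _ _) (hS_indep.comp (fun p => deviation l f μ θ p.1) fun p => hdm p.1)
    Finset.univ (lipschitzWith_coordMax (K := K))
  simp only [Fintype.sum_prod_type] at hsub
  have hN : (0 : ℝ) < n * m := by positivity
  have htail := hsub.measure_ge_le (mul_nonneg hN.le hε)
  have hE := integral_coordMax_deviation_le hm hn hS_law hS_indep hf hl hl_range hl_lip hrad hθ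
  calc _ ≤ _ := measureReal_mono fun ω hω => ?_
    _ ≤ _ := htail
    _ = _ := ?_
  · obtain ⟨k, hk⟩ := hω
    have h1 := le_coordMax (∑ i, ∑ j, deviation l f μ θ i (S i j ω)) k
    rw [sum_deviation_apply hm hn (fun i j => S i j ω)] at h1
    have h2 := mul_lt_mul_of_pos_left hk hN
    simp only [Set.mem_ofPred_eq]
    linarith
  · congr 1
    have hm' : (m : ℝ) ≠ 0 := by positivity
    have hn' : (n : ℝ) ≠ 0 := by positivity
    simp only [Finset.card_univ, Fintype.card_prod, Fintype.card_fin]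
    push_cast
    field_simp

end FiniteClass

end Learning

/-! ### From finite subclasses to the constraint set, and the exponential transform -/

section Generalization

variable {X Y Ω Param : Type*} {m n : ℕ} {f : Fin m → X → Param → ℝ} {C : Set Param}
  {l : ℝ → Y → ℝ} {ρ : ℝ≥0}

/-- Jensen for the exponential with uniform weights on the tasks. -/
lemma exp_mean_le_empiricalRisk (hm : 0 < m) (T : ℝ) (D : Fin m → Fin n → X × Y) (Θ : Param) :
    Real.exp (((1 / (m : ℝ)) * ∑ i, empiricalTaskRisk l f D i Θ) / T) ≤
      empiricalRisk (expTransform T) l f D Θ := by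
  have hm' : (m : ℝ) ≠ 0 := by positivity
  have h := convexOn_exp.map_sum_le (t := (Finset.univ : Finset (Fin m)))
    (w := fun _ => 1 / (m : ℝ)) (p := fun i => empiricalTaskRisk l f D i Θ / T)
    (fun _ _ => by positivity) (by simp [hm']) (fun _ _ => Set.mem_univ _)
  simp only [smul_eq_mul, ← Finset.mul_sum, ← Finset.sum_div] at h
  rw [mul_div_assoc]
  exact h

variable [MeasurableSpace X] [MeasurableSpace Y] {μ : Fin m → Measure (X × Y)}
  [∀ i, IsProbabilityMeasure (μ i)] [MeasurableSpace Ω] {P : Measure Ω} [IsProbabilityMeasure P]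
  {S : Fin m → Fin n → Ω → X × Y}

/-- Uniform deviation bound over a countable subclass. -/
lemma measure_exists_nat_riskGap_le (hm : 0 < m) (hn : 0 < n)
    (hS_law : ∀ i j, HasLaw (S i j) (μ i) P)
    (hS_indep : iIndepFun (fun p : Fin m × Fin n => S p.1 p.2) P)
    (hf : ∀ i Θ, Measurable (fun x => f i x Θ)) (hl : Measurable (Function.uncurry l))
    (hl_range : ∀ a y, l a y ∈ Set.Icc (0 : ℝ) 1)
    (hl_lip : ∀ y, LipschitzWith ρ (fun a => l a y)) (hrad : HasRademacherComplexity P f C S)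
    {θ : ℕ → Param} (hθ : ∀ k, θ k ∈ C) {ε : ℝ} (hε : 0 ≤ ε) :
    P.real {ω | ∃ k, 8 * ρ * rademacherComplexity P f C S + ε <
        riskGap l f μ (fun i j => S i j ω) (θ k)} ≤ Real.exp (-(m * n * ε ^ 2 / 2)) := by
  set B := 8 * ρ * rademacherComplexity P f C S + ε with hB
  -- `Fin (N + 1)` rather than `Fin N`, because `coordMax` needs a nonempty index type. The bound
  -- does not depend on `N`, so it survives the increasing union.
  let A (N : ℕ) : Set Ω :=
    {ω | ∃ k : Fin (N + 1), B < riskGap l f μ (fun i j => S i j ω) (θ k)}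
  have hA : Monotone A := by
    rintro N N' hN ω ⟨k, hk⟩
    exact ⟨⟨k, by omega⟩, hk⟩
  have hU : {ω | ∃ k, B < riskGap l f μ (fun i j => S i j ω) (θ k)} = ⋃ N, A N := by
    ext ω
    simp only [Set.mem_ofPred_eq, Set.mem_iUnion, A]
    exact ⟨fun ⟨k, hk⟩ => ⟨k, ⟨k, by omega⟩, hk⟩, fun ⟨_, k, hk⟩ => ⟨k, hk⟩⟩
  rw [hU, measureReal_def, hA.measure_iUnion]
  refine ENNReal.toReal_le_of_le_ofReal (Real.exp_nonneg _) (iSup_le fun N => ?_)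
  rw [← ENNReal.ofReal_toReal (measure_ne_top P (A N))]
  exact ENNReal.ofReal_le_ofReal (measure_exists_riskGap_le hm hn hS_law hS_indep hf hl hl_range
    hl_lip hrad (θ := fun k : Fin (N + 1) => θ k) (fun k => hθ k) hε)

/-- The gap is continuous along pointwise convergent sequences of learning functions. -/
lemma tendsto_riskGap (hf : ∀ i Θ, Measurable (fun x => f i x Θ))
    (hl : Measurable (Function.uncurry l)) (hl_range : ∀ a y, l a y ∈ Set.Icc (0 : ℝ) 1)
    (hl_lip : ∀ y, LipschitzWith ρ (fun a => l a y)) (D : Fin m → Fin n → X × Y)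
    {u : ℕ → Param} {Θ : Param}
    (hu : ∀ i x, Tendsto (fun k => f i x (u k)) atTop (𝓝 (f i x Θ))) :
    Tendsto (fun k => riskGap l f μ D (u k)) atTop (𝓝 (riskGap l f μ D Θ)) := by
  have hloss : ∀ i (z : X × Y), Tendsto (fun k => l (f i z.1 (u k)) z.2) atTop
      (𝓝 (l (f i z.1 Θ) z.2)) := fun i z =>
    ((hl_lip z.2).continuous.tendsto _).comp (hu i z.1)
  refine Tendsto.sub (Tendsto.const_mul _ (tendsto_finsetSum _ fun i _ => ?_))
    (Tendsto.const_mul _ (tendsto_finsetSum _ fun i _ =>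
      Tendsto.const_mul _ (tendsto_finsetSum _ fun j _ => hloss i (D i j))))
  refine tendsto_integral_of_dominated_convergence (fun _ => (1 : ℝ))
    (fun k => (measurable_loss hf hl i (u k)).aestronglyMeasurable) (integrable_const _)
    (fun k => ae_of_all _ fun z => ?_) (ae_of_all _ fun z => hloss i z)
  have h := hl_range (f i z.1 (u k)) z.2
  rw [Real.norm_eq_abs, abs_le]
  exact ⟨by linarith [h.1], h.2⟩

lemma averageRisk_le_one (hm : 0 < m) (hf : ∀ i Θ, Measurable (fun x => f i x Θ))
    (hl : Measurable (Function.uncurry l)) (hl_range : ∀ a y, l a y ∈ Set.Icc (0 : ℝ) 1)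
    (Θ : Param) : averageRisk l f μ Θ ≤ 1 := by
  have h : ∑ i, taskRisk l f μ i Θ ≤ ∑ _i : Fin m, (1 : ℝ) :=
    Finset.sum_le_sum fun i _ => (taskRisk_mem_Icc hf hl hl_range i Θ).2
  have hm' : (0 : ℝ) < m := by exact_mod_cast hm
  rw [averageRisk, one_div, inv_mul_le_iff₀ hm']
  simpa using h

/-- A bound on the gap carries over to the exponentially transformed empirical risk. -/
lemma averageRisk_le_of_riskGap_le (hm : 0 < m) (hf : ∀ i Θ, Measurable (fun x => f i x Θ))
    (hl : Measurable (Function.uncurry l)) (hl_range : ∀ a y, l a y ∈ Set.Icc (0 : ℝ) 1)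
    {T : ℝ} (hT : 0 < T) {D : Fin m → Fin n → X × Y} {Θ : Param} {B M : ℝ} (hB : 0 ≤ B)
    (hgap : riskGap l f μ D Θ ≤ B)
    (hM : nu T * B + empiricalRisk (expTransform T) l f D Θ ≤ M) :
    averageRisk l f μ Θ ≤ T * Real.log M := by
  have h1 := averageRisk_le_one (μ := μ) hm hf hl hl_range Θ
  have h2 := exp_mean_le_empiricalRisk (l := l) (f := f) hm T D Θ
  rw [riskGap] at hgap
  set R := averageRisk l f μ Θ
  set r := (1 / (m : ℝ)) * ∑ i, empiricalTaskRisk l f D i Θ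
  -- Tangent-line inequality 1 - exp(-x) ≤ x with x = (R - r)/T, followed by R ≤ 1. The last
  -- replacement of exp(R/T) by exp(1/T) uses `0 ≤ B`.
  have h3 : Real.exp (R / T) - Real.exp (r / T) ≤ nu T * B := by
    have h4 : Real.exp (r / T) = Real.exp (R / T) * Real.exp ((r - R) / T) := by
      rw [← Real.exp_add]; ring_nf
    have h5 := Real.add_one_le_exp ((r - R) / T)
    have h6 : Real.exp (R / T) ≤ Real.exp (1 / T) :=
      Real.exp_le_exp.2 (div_le_div_of_nonneg_right h1 hT.le)
    calc Real.exp (R / T) - Real.exp (r / T)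
        = Real.exp (R / T) * (1 - Real.exp ((r - R) / T)) := by rw [h4]; ring
      _ ≤ Real.exp (R / T) * ((R - r) / T) := by
          refine mul_le_mul_of_nonneg_left ?_ (Real.exp_nonneg _)
          have : (r - R) / T = -((R - r) / T) := by ring
          linarith
      _ ≤ Real.exp (R / T) * (B / T) := mul_le_mul_of_nonneg_left
          (div_le_div_of_nonneg_right hgap hT.le) (Real.exp_nonneg _)
      _ ≤ Real.exp (1 / T) * (B / T) := mul_le_mul_of_nonneg_right h6 (by positivity)
      _ = nu T * B := by rw [nu]; ring
  have h7 : Real.exp (R / T) ≤ M := by linarith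
  have h8 : R / T ≤ Real.log M :=
    (Real.le_log_iff_exp_le ((Real.exp_pos _).trans_le h7)).2 h7
  rwa [div_le_iff₀' hT] at h8

end Generalization

/-- The left side is `eta` with exp(x) - 1 replaced by its linear part x, at x = 1/(nT). -/
lemma two_mul_nu_div_le_eta {m n : ℕ} (hm : 0 < m) (hn : 0 < n) {T : ℝ} (hT : 0 < T) :
    2 * nu T / (m * n) ≤ eta m n T := by
  have hm' : (0 : ℝ) < m := by exact_mod_cast hm
  have hn' : (0 : ℝ) < n := by exact_mod_cast hn
  have h := Real.add_one_le_exp (1 / ((n : ℝ) * T))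
  calc 2 * nu T / (m * n) = (2 / (m : ℝ)) * Real.exp (1 / T) * (1 / ((n : ℝ) * T)) := by
        rw [nu]; field_simp
    _ ≤ eta m n T := mul_le_mul_of_nonneg_left (by linarith) (by positivity)

lemma nu_mul_sqrt_le {m n : ℕ} (hm : 0 < m) (hn : 0 < n) {T : ℝ} (hT : 0 < T) {c : ℝ}
    (hc : 0 ≤ c) :
    nu T * Real.sqrt (2 * c / (m * n)) ≤ Real.sqrt (eta m n T ^ 2 * m * n / 2 * c) := by
  have hm' : (0 : ℝ) < m := by exact_mod_cast hm
  have hn' : (0 : ℝ) < n := by exact_mod_cast hn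
  have hν : 0 ≤ nu T := by rw [nu]; positivity
  refine Real.le_sqrt_of_sq_le ?_
  rw [mul_pow, Real.sq_sqrt (by positivity)]
  have h := pow_le_pow_left₀ (by positivity) (two_mul_nu_div_le_eta hm hn hT) 2
  calc nu T ^ 2 * (2 * c / (m * n)) = (2 * nu T / (m * n)) ^ 2 * (m * n / 2 * c) := by
        field_simp
    _ ≤ eta m n T ^ 2 * (m * n / 2 * c) := mul_le_mul_of_nonneg_right h (by positivity)
    _ = _ := by ring

end BMTL

theorem theorem4 {X Y Ω Param : Type*} [MeasurableSpace X] [MeasurableSpace Y]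
    [MeasurableSpace Ω] (P : Measure Ω) [IsProbabilityMeasure P]
    {m n : ℕ} (hm : 0 < m) (hn : 0 < n)
    (μ : Fin m → Measure (X × Y)) [∀ i, IsProbabilityMeasure (μ i)]
    (S : Fin m → Fin n → Ω → X × Y)
    (hS_law : ∀ i j, HasLaw (S i j) (μ i) P)
    (hS_indep : iIndepFun (fun p : Fin m × Fin n => S p.1 p.2) P)
    (f : Fin m → X → Param → ℝ) (hf : ∀ i Θ, Measurable (fun x => f i x Θ))
    (l : ℝ → Y → ℝ) (hl : Measurable (Function.uncurry l))
    (hl_range : ∀ a y, l a y ∈ Set.Icc (0 : ℝ) 1)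
    (ρ : ℝ≥0) (hl_lip : ∀ y, LipschitzWith ρ (fun a => l a y))
    (r : Param → ℝ) (β : ℝ)
    (hsep : BMTL.PointwiseSeparable f (BMTL.constraintSet r β))
    (hrad : BMTL.HasRademacherComplexity P f (BMTL.constraintSet r β) S)
    (T : ℝ) (hT : 0 < T) (δ : ℝ) (hδ : 0 < δ) :
    1 - δ ≤ P.real {ω | ∀ Θ ∈ BMTL.constraintSet r β,
      BMTL.averageRisk l f μ Θ ≤
        T * Real.log
          (8 * (ρ : ℝ) * BMTL.nu T *
              BMTL.rademacherComplexity P f (BMTL.constraintSet r β) S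
            + BMTL.empiricalRisk (BMTL.expTransform T) l f (fun i j => S i j ω) Θ
            + Real.sqrt (BMTL.eta m n T ^ 2 * (m : ℝ) * (n : ℝ) / 2 * Real.log (1 / δ)))} := by
  rcases le_or_gt 1 δ with hδ1 | hδ1
  · linarith [measureReal_nonneg (μ := P) (s := {ω | ∀ Θ ∈ BMTL.constraintSet r β,
      BMTL.averageRisk l f μ Θ ≤
        T * Real.log
          (8 * (ρ : ℝ) * BMTL.nu T *
              BMTL.rademacherComplexity P f (BMTL.constraintSet r β) S
            + BMTL.empiricalRisk (BMTL.expTransform T) l f (fun i j => S i j ω) Θ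
            + Real.sqrt (BMTL.eta m n T ^ 2 * (m : ℝ) * (n : ℝ) / 2 * Real.log (1 / δ)))})]
  obtain ⟨C₀, hC₀, hcount, hdense⟩ := hsep
  -- A point of the constraint set is needed both to enumerate `C₀` by a sequence and to know that
  -- the complexity is nonnegative.
  rcases (BMTL.constraintSet r β).eq_empty_or_nonempty with hC | hC
  · simp only [hC, Set.mem_empty_iff_false, false_imp_iff, implies_true, Set.ofPred_true,
      probReal_univ]
    linarith
  obtain ⟨θ, hθ⟩ := hcount.exists_eq_range
    (hC.elim fun Θ hΘ => (hdense Θ hΘ).elim fun u hu => ⟨u 0, hu.1 0⟩)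
  have hlog : 0 ≤ Real.log (1 / δ) := Real.log_nonneg (by rw [le_div_iff₀ hδ]; linarith)
  -- Chosen so that the tail bound exp(-mnε²/2) equals δ.
  set ε := Real.sqrt (2 * Real.log (1 / δ) / (m * n)) with hε
  set B := 8 * (ρ : ℝ) * BMTL.rademacherComplexity P f (BMTL.constraintSet r β) S + ε with hB
  have hB0 : 0 ≤ B := by
    have := BMTL.rademacherComplexity_nonneg hC hrad
    positivity
  have htail := BMTL.measure_exists_nat_riskGap_le hm hn hS_law hS_indep hf hl hl_range hl_lip
    hrad (θ := θ) (fun k => hC₀ (hθ ▸ Set.mem_range_self k)) (Real.sqrt_nonneg _ : 0 ≤ ε)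
  have hexp : Real.exp (-(m * n * ε ^ 2 / 2)) = δ := by
    have hm' : (0 : ℝ) < m := by exact_mod_cast hm
    have hn' : (0 : ℝ) < n := by exact_mod_cast hn
    rw [hε, Real.sq_sqrt (by positivity)]
    have : -(m * n * (2 * Real.log (1 / δ) / (m * n)) / 2) = Real.log δ := by
      rw [one_div, Real.log_inv]; field_simp
    rw [this, Real.exp_log hδ]
  rw [hexp, ← hB] at htail
  set A := {ω | ∃ k, B < BMTL.riskGap l f μ (fun i j => S i j ω) (θ k)} with hA
  have hcompl : 1 - δ ≤ P.real Aᶜ := by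
    have h1 := measureReal_union_le (μ := P) A Aᶜ
    rw [Set.union_compl_self, probReal_univ] at h1
    linarith
  refine hcompl.trans (measureReal_mono fun ω hω Θ hΘ => ?_)
  have hω' : ∀ Θ' ∈ C₀, BMTL.riskGap l f μ (fun i j => S i j ω) Θ' ≤ B := by
    rw [hθ]
    rintro _ ⟨k, rfl⟩
    exact not_lt.1 fun h => hω ⟨k, h⟩
  obtain ⟨u, hu, hlim⟩ := hdense Θ hΘ
  have hgap : BMTL.riskGap l f μ (fun i j => S i j ω) Θ ≤ B :=
    le_of_tendsto' (BMTL.tendsto_riskGap hf hl hl_range hl_lip (fun i j => S i j ω) hlim)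
      fun k => hω' _ (hu k)
  refine BMTL.averageRisk_le_of_riskGap_le hm hf hl hl_range hT hB0 hgap ?_
  have := BMTL.nu_mul_sqrt_le hm hn hT hlog
  rw [hB, mul_add, ← hε] at *
  linarith
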